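/- Let $d,\bar\ell\ge 1$ and let $\bar H$ be a positive semidefinite operator on $\mathbb{C}^d\otimes\mathbb{C}^d$. A segment is an open chain of $\bar\ell$ spins of dimension $d$, with Hamiltonian $\bar H^S=\sum_{i=0}^{\bar\ell-2} I^{\otimes(\bar\ell-2-i)}\otimes\bar H\otimes I^{\otimes i}$; let $\bar P$ be the orthogonal projection onto $\ker\bar H^S$. For $m$ segments, acting on $(\mathbb{C}^d)^{\otimes m\bar\ell}$, put \[ H^S_m=\sum_{i=0}^{m-1} I^{\otimes (m-1-i)\bar\ell}\otimes\bar H^S\otimes I^{\otimes i\bar\ell},\qquad H^L_m=\sum_{i=1}^{m-1} I^{\otimes(m\bar\ell-i\bar\ell-1)}\otimes\bar H\otimes I^{\otimes(i\bar\ell-1)},\qquad P^S_m=\bar P^{\otimes m}, \] and let $H_m=H^S_m+H^L_m$ be the Hamiltonian of the linked segments and $h_m=P^S_mH^L_mP^S_m$ the renormalized Hamiltonian. Suppose that the chain is frustration-free, i.e. $\ker H_m\neq\{0\}$ for every $m$. Call a sequence of Hermitian operators $(A_m)_m$ gapped if there is $\gamma>0$, independent of $m$, such that for every $m$ each eigenvalue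 of $A_m$ other than the lowest one exceeds the lowest one by at least $\gamma$. Then, for the fixed segment length $\bar\ell$, $(H_m)_m$ is gapped if and only if $(h_m)_m$ is gapped. -/

import Mathlib

noncomputable section

namespace SpinChain

/-- A two-spin operator `Hbar` on `ℂ^d ⊗ ℂ^d`, acting on the spins at the sites `a` (left tensor
factor) and `b` (right tensor factor) of a system of spins with sites `ι`, and as the identity on
all other spins. The Hilbert space `(ℂ^d)^{⊗ ι}` has the basis of configurations `ι → Fin d`. -/
def bondOp {d : ℕ} {ι : Type} [Fintype ι] [DecidableEq ι]
    (Hbar : Matrix (Fin d × Fin d) (Fin d × Fin d) ℂ) (a b : ι) :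
    Matrix (ι → Fin d) (ι → Fin d) ℂ :=
  Matrix.of fun s t =>
    if ∀ c, c ≠ a → c ≠ b → s c = t c then Hbar (s a, s b) (t a, t b) else 0

/-- The Hamiltonian of one segment, an open chain of `L` spins: the sum of the couplings of all
pairs of adjacent spins. -/
def segmentHam {d : ℕ} (Hbar : Matrix (Fin d × Fin d) (Fin d × Fin d) ℂ) (L : ℕ) :
    Matrix (Fin L → Fin d) (Fin L → Fin d) ℂ :=
  ∑ i : Fin L, ∑ k : Fin L, if (i : ℕ) + 1 = (k : ℕ) then bondOp Hbar i k else 0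

/-- The matrix of the orthogonal projection onto the kernel of `A`. -/
def kerProj {n : Type} [Fintype n] [DecidableEq n] (A : Matrix n n ℂ) : Matrix n n ℂ :=
  (Matrix.toEuclideanCLM (n := n) (𝕜 := ℂ)).symm
    (LinearMap.ker (Matrix.toEuclideanCLM (n := n) (𝕜 := ℂ) A).toLinearMap).starProjection

/-- The projection onto the zero-energy states of one segment. -/
def segmentProj {d : ℕ} (Hbar : Matrix (Fin d × Fin d) (Fin d × Fin d) ℂ) (L : ℕ) :
    Matrix (Fin L → Fin d) (Fin L → Fin d) ℂ :=
  kerProj (segmentHam Hbar L)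

/-- The configurations of a chain of `m` segments with `L` spins each. The site `(j, k)` is the
`k`-th spin of the `j`-th segment; the sites are ordered lexicographically along the chain. -/
abbrev Config (d L m : ℕ) : Type := Fin m × Fin L → Fin d

/-- An operator `A` on one segment, acting on the `j`-th segment of the chain, and as the identity
on all other segments. -/
def onSegment {d L m : ℕ} (A : Matrix (Fin L → Fin d) (Fin L → Fin d) ℂ) (j : Fin m) :
    Matrix (Config d L m) (Config d L m) ℂ :=
  Matrix.of fun s t =>
    if ∀ c : Fin m × Fin L, c.1 ≠ j → s c = t c then
      A (fun k => s (j, k)) (fun k => t (j, k)) else 0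

/-- The Hamiltonian `H^S` of the `m` unlinked segments. -/
def segmentsHam {d : ℕ} (Hbar : Matrix (Fin d × Fin d) (Fin d × Fin d) ℂ) (L m : ℕ) :
    Matrix (Config d L m) (Config d L m) ℂ :=
  ∑ j : Fin m, onSegment (segmentHam Hbar L) j

/-- `b` is the first spin of the segment that follows the one of which `a` is the last spin. -/
def IsLink {L m : ℕ} (a b : Fin m × Fin L) : Prop :=
  (a.1 : ℕ) + 1 = (b.1 : ℕ) ∧ (a.2 : ℕ) + 1 = L ∧ (b.2 : ℕ) = 0

instance {L m : ℕ} (a b : Fin m × Fin L) : Decidable (IsLink a b) := by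
  unfold IsLink; infer_instance

/-- The link Hamiltonian `H^L`, which couples the last spin of each segment with the first spin of
the next one. -/
def linkHam {d : ℕ} (Hbar : Matrix (Fin d × Fin d) (Fin d × Fin d) ℂ) (L m : ℕ) :
    Matrix (Config d L m) (Config d L m) ℂ :=
  ∑ a : Fin m × Fin L, ∑ b : Fin m × Fin L, if IsLink a b then bondOp Hbar a b else 0

/-- The Hamiltonian `H = H^S + H^L` of `m` linked segments of length `L`. -/
def chainHam {d : ℕ} (Hbar : Matrix (Fin d × Fin d) (Fin d × Fin d) ℂ) (L m : ℕ) :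
    Matrix (Config d L m) (Config d L m) ℂ :=
  segmentsHam Hbar L m + linkHam Hbar L m

/-- The projection `P^S`, the tensor product over the segments of the projections onto the
zero-energy states of a segment. -/
def segmentsProj {d : ℕ} (Hbar : Matrix (Fin d × Fin d) (Fin d × Fin d) ℂ) (L m : ℕ) :
    Matrix (Config d L m) (Config d L m) ℂ :=
  Matrix.of fun s t =>
    ∏ j : Fin m, segmentProj Hbar L (fun k => s (j, k)) (fun k => t (j, k))

/-- The renormalized Hamiltonian `h = P^S H^L P^S`. -/
def renormHam {d : ℕ} (Hbar : Matrix (Fin d × Fin d) (Fin d × Fin d) ℂ) (L m : ℕ) :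
    Matrix (Config d L m) (Config d L m) ℂ :=
  segmentsProj Hbar L m * linkHam Hbar L m * segmentsProj Hbar L m

/-- `γ` is a lower bound for the spectral gap of the Hermitian matrix `A`: every eigenvalue other
than the lowest one exceeds the lowest one by at least `γ`. -/
def GapAtLeast {n : Type} [Fintype n] [DecidableEq n] (A : Matrix n n ℂ) (γ : ℝ) : Prop :=
  ∀ E₀ E : ℝ, IsLeast (spectrum ℝ A) E₀ → E ∈ spectrum ℝ A → E ≠ E₀ → γ ≤ E - E₀

/-- A sequence of Hamiltonians is gapped if the spectral gap is bounded below by a positive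
constant, uniformly in the system size `m`. -/
def IsGapped {n : ℕ → Type} [∀ m, Fintype (n m)] [∀ m, DecidableEq (n m)]
    (A : ∀ m, Matrix (n m) (n m) ℂ) : Prop :=
  ∃ γ : ℝ, 0 < γ ∧ ∀ m, GapAtLeast (A m) γ

open scoped ComplexOrder in
/-- The chain is frustration-free: the Hamiltonian, a sum of positive semidefinite couplings, has
a nonzero state of energy zero at every system size. -/
def IsFrustrationFree {d : ℕ} (Hbar : Matrix (Fin d × Fin d) (Fin d × Fin d) ℂ) (L : ℕ) : Prop :=
  Hbar.PosSemidef ∧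
    ∀ m : ℕ, ∃ ψ : Config d L m → ℂ, ψ ≠ 0 ∧ (chainHam Hbar L m).mulVec ψ = 0

end SpinChain

end

namespace SpinChain

open Matrix
open scoped MatrixOrder ComplexOrder

section Spectral

variable {n : Type} [Fintype n] [DecidableEq n]

lemma conj_le {A B : Matrix n n ℂ} (h : A ≤ B) (C : Matrix n n ℂ) : Cᴴ * A * C ≤ Cᴴ * B * C := by
  rw [le_iff] at h ⊢
  have := h.conjTranspose_mul_mul_same C
  rwa [mul_sub, sub_mul] at this

lemma conj_le_of_isHermitian {A B C : Matrix n n ℂ} (h : A ≤ B) (hC : C.IsHermitian) :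
    C * A * C ≤ C * B * C := by
  simpa only [hC.eq] using conj_le h C

lemma conj_nonneg {A C : Matrix n n ℂ} (h : 0 ≤ A) (hC : C.IsHermitian) : 0 ≤ C * A * C := by
  simpa using conj_le_of_isHermitian h hC

lemma nonneg_of_isHermitian_of_mul_self {P : Matrix n n ℂ} (hP : P.IsHermitian) (hPP : P * P = P) :
    0 ≤ P := by
  simpa [hPP] using conj_nonneg (zero_le_one (α := Matrix n n ℂ)) hP

lemma mul_eq_zero_of_conj_eq_zero {A B : Matrix n n ℂ} (hA : 0 ≤ A) (h : Bᴴ * A * B = 0) :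
    A * B = 0 := by
  obtain ⟨C, rfl⟩ := CStarAlgebra.nonneg_iff_eq_star_mul_self.1 hA
  have : (C * B)ᴴ * (C * B) = 0 := by
    rw [conjTranspose_mul, ← h]; simp only [mul_assoc, star_eq_conjTranspose]
  rw [mul_assoc, conjTranspose_mul_self_eq_zero.1 this, mul_zero]

lemma isHermitian_kerProj (A : Matrix n n ℂ) : (kerProj A).IsHermitian := by
  unfold kerProj
  set K := LinearMap.ker (toEuclideanCLM (n := n) (𝕜 := ℂ) A).toLinearMap
  have h : star K.starProjection = K.starProjection := isSelfAdjoint_starProjection _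
  have h2 := (toEuclideanCLM (n := n) (𝕜 := ℂ)).symm.map_star' K.starProjection
  rw [h] at h2
  exact h2.symm

lemma kerProj_mul_self (A : Matrix n n ℂ) : kerProj A * kerProj A = kerProj A := by
  unfold kerProj
  rw [← map_mul]
  congr 1
  exact (Submodule.isIdempotentElem_starProjection _)

lemma toEuclideanCLM_kerProj (A : Matrix n n ℂ) :
    toEuclideanCLM (n := n) (𝕜 := ℂ) (kerProj A) =
      (LinearMap.ker (toEuclideanCLM (n := n) (𝕜 := ℂ) A).toLinearMap).starProjection :=
  StarAlgEquiv.apply_symm_apply _ _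

lemma mul_kerProj (A : Matrix n n ℂ) : A * kerProj A = 0 := by
  refine (toEuclideanCLM (n := n) (𝕜 := ℂ)).injective ?_
  show toEuclideanCLM (n := n) (𝕜 := ℂ) (A * kerProj A) = toEuclideanCLM (n := n) (𝕜 := ℂ) 0
  rw [map_mul, map_zero, toEuclideanCLM_kerProj]
  ext1 x
  exact Submodule.starProjection_apply_mem (LinearMap.ker
    (toEuclideanCLM (n := n) (𝕜 := ℂ) A).toLinearMap) x

lemma kerProj_mul (A : Matrix n n ℂ) : kerProj A * Aᴴ = 0 := by
  rw [← conjTranspose_eq_zero, conjTranspose_mul, conjTranspose_conjTranspose,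
    (isHermitian_kerProj A).eq, mul_kerProj]

lemma kerProj_mulVec {A : Matrix n n ℂ} {v : n → ℂ} (h : A *ᵥ v = 0) : kerProj A *ᵥ v = v := by
  have h1 : toEuclideanCLM (n := n) (𝕜 := ℂ) (kerProj A) (WithLp.toLp 2 v) = WithLp.toLp 2 v := by
    rw [toEuclideanCLM_kerProj, Submodule.starProjection_eq_self_iff,
      LinearMap.mem_ker]
    show toEuclideanCLM (n := n) (𝕜 := ℂ) A (WithLp.toLp 2 v) = 0
    rw [toEuclideanCLM_toLp, h]; rfl
  rw [toEuclideanCLM_toLp] at h1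
  exact congrArg WithLp.ofLp h1

lemma kerProj_mul_of_mul_eq_zero {A B : Matrix n n ℂ} (h : A * B = 0) : kerProj A * B = B := by
  ext i j
  have h0 : A *ᵥ B.col j = 0 := by
    ext k; exact congrFun (congrFun h k) j
  exact congrFun (kerProj_mulVec h0) i

lemma posSemidef_of_eigenbasis {A M : Matrix n n ℂ} (hA : A.IsHermitian) (μ : n → ℝ)
    (hμ : ∀ i, 0 ≤ μ i)
    (h : ∀ i, M *ᵥ (hA.eigenvectorBasis i).ofLp = μ i • (hA.eigenvectorBasis i).ofLp) :
    M.PosSemidef := by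
  set U : Matrix n n ℂ := (hA.eigenvectorUnitary : Matrix n n ℂ)
  have hU : U * Uᴴ = 1 := Unitary.coe_mul_star_self hA.eigenvectorUnitary
  have h1 : M * U = U * diagonal (fun i => (μ i : ℂ)) := by
    ext i j
    rw [mul_diagonal]
    have := congrFun (h j) i
    simpa [mul_comm, U, mul_apply, mulVec, dotProduct] using this
  have h2 : M = U * diagonal (fun i => (μ i : ℂ)) * Uᴴ := by
    rw [← h1, mul_assoc, hU, mul_one]
  rw [h2]
  exact (PosSemidef.diagonal fun i => by simpa using hμ i).mul_mul_conjTranspose_same U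

lemma exists_le_smul_one {A : Matrix n n ℂ} (hA : A.IsHermitian) :
    ∃ c : ℝ, 0 ≤ c ∧ A ≤ c • (1 : Matrix n n ℂ) := by
  refine ⟨∑ i, |hA.eigenvalues i|, by positivity, ?_⟩
  rw [le_iff]
  refine posSemidef_of_eigenbasis hA (fun i => ∑ k, |hA.eigenvalues k| - hA.eigenvalues i)
    (fun i => sub_nonneg.2 ((le_abs_self _).trans
      (Finset.single_le_sum (fun k _ => abs_nonneg (hA.eigenvalues k)) (Finset.mem_univ i))))
    fun i => ?_
  rw [sub_mulVec, hA.mulVec_eigenvectorBasis, smul_mulVec, one_mulVec, ← sub_smul]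

lemma smul_one_sub_kerProj_le {A : Matrix n n ℂ} (hA : 0 ≤ A) {γ : ℝ}
    (h : ∀ i, (nonneg_iff_posSemidef.1 hA).isHermitian.eigenvalues i ≠ 0 →
      γ ≤ (nonneg_iff_posSemidef.1 hA).isHermitian.eigenvalues i) :
    γ • (1 - kerProj A) ≤ A := by
  have hA' := nonneg_iff_posSemidef.1 hA
  set H := hA'.isHermitian
  rw [le_iff]
  refine posSemidef_of_eigenbasis H (fun i => if H.eigenvalues i = 0 then 0
    else H.eigenvalues i - γ) (fun i => ?_) fun i => ?_
  · split_ifs with h0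
    · rfl
    · exact sub_nonneg.2 (h i h0)
  · have he := H.mulVec_eigenvectorBasis i
    split_ifs with h0
    · rw [h0, zero_smul] at he
      simp [sub_mulVec, smul_mulVec, he, kerProj_mulVec he]
    · have hk : kerProj A *ᵥ (H.eigenvectorBasis i).ofLp = 0 := by
        have := congrArg (kerProj A *ᵥ ·) he
        simp only [mulVec_mulVec, mulVec_smul] at this
        have h3 := kerProj_mul A
        rw [H.eq] at h3
        rw [h3, zero_mulVec] at this
        exact (smul_eq_zero.1 this.symm).resolve_left h0
      simp [sub_mulVec, smul_mulVec, he, hk, sub_smul]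

lemma exists_pos_smul_one_sub_kerProj_le {A : Matrix n n ℂ} (hA : 0 ≤ A) :
    ∃ δ : ℝ, 0 < δ ∧ δ • (1 - kerProj A) ≤ A := by
  have hA' := nonneg_iff_posSemidef.1 hA
  set s := Finset.univ.filter fun i => hA'.isHermitian.eigenvalues i ≠ 0
  rcases s.eq_empty_or_nonempty with hs | hs
  · refine ⟨1, one_pos, smul_one_sub_kerProj_le hA fun i hi => ?_⟩
    have : i ∈ s := by simp [s, hi]
    simp [hs] at this
  · obtain ⟨k, hk, hmin⟩ := s.exists_min_image hA'.isHermitian.eigenvalues hs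
    refine ⟨hA'.isHermitian.eigenvalues k, ?_, smul_one_sub_kerProj_le hA fun i hi =>
      hmin i (by simp [s, hi])⟩
    exact (hA'.eigenvalues_nonneg k).lt_of_ne' (by simpa [s] using hk)

lemma gapAtLeast_iff {A : Matrix n n ℂ} (hA : 0 ≤ A) (hker : ∃ ψ : n → ℂ, ψ ≠ 0 ∧ A *ᵥ ψ = 0)
    (γ : ℝ) : GapAtLeast A γ ↔ γ • (1 - kerProj A) ≤ A := by
  have hA' := nonneg_iff_posSemidef.1 hA
  set H := hA'.isHermitian
  have hspec := H.spectrum_real_eq_range_eigenvalues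
  have h0 : IsLeast (spectrum ℝ A) 0 := by
    constructor
    · rw [spectrum.zero_mem_iff]
      intro hu
      obtain ⟨ψ, hψ, h⟩ := hker
      obtain ⟨B, hB⟩ := hu.exists_left_inv
      apply hψ
      rw [← one_mulVec ψ, ← hB, ← mulVec_mulVec, h, mulVec_zero]
    · rw [hspec]
      rintro _ ⟨i, rfl⟩
      exact hA'.eigenvalues_nonneg i
  constructor
  · intro h
    refine smul_one_sub_kerProj_le hA fun i hi => ?_
    simpa using h 0 _ h0 (H.eigenvalues_mem_spectrum_real i) hi
  · intro h E₀ E hE₀ hE hne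
    obtain rfl := hE₀.unique h0
    rw [hspec] at hE
    obtain ⟨i, rfl⟩ := hE
    have he := H.mulVec_eigenvectorBasis i
    set e := (H.eigenvectorBasis i).ofLp
    have hk : kerProj A *ᵥ e = 0 := by
      have := congrArg (kerProj A *ᵥ ·) he
      simp only [mulVec_mulVec, mulVec_smul] at this
      have h3 := kerProj_mul A
      rw [H.eq] at h3
      rw [h3, zero_mulVec] at this
      exact (smul_eq_zero.1 this.symm).resolve_left hne
    have hn : star e ⬝ᵥ e = 1 := by
      have := (H.eigenvectorBasis).inner_eq_one i
      rwa [EuclideanSpace.inner_eq_star_dotProduct, dotProduct_comm] at this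
    have hpos := (le_iff.1 h).dotProduct_mulVec_nonneg e
    simp only [sub_mulVec, smul_mulVec, he, hk, one_mulVec, sub_zero, ← sub_smul,
      dotProduct_smul, hn] at hpos
    simpa using hpos

end Spectral

section Transfer

variable {n : Type} [Fintype n] [DecidableEq n]

lemma isHermitian_of_nonneg {A : Matrix n n ℂ} (hA : 0 ≤ A) : A.IsHermitian :=
  (nonneg_iff_posSemidef.1 hA).isHermitian

lemma one_sub_kerProj_conj {A : Matrix n n ℂ} (hA : A.IsHermitian) :
    (1 - kerProj A) * A * (1 - kerProj A) = A := by
  have h := kerProj_mul A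
  rw [hA.eq] at h
  rw [sub_mul, one_mul, h, sub_zero, mul_sub, mul_one, mul_kerProj, sub_zero]

lemma isHermitian_one_sub {A : Matrix n n ℂ} (hA : A.IsHermitian) : (1 - A).IsHermitian :=
  isHermitian_one.sub hA

/-- The data relating a Hamiltonian `HS + HL` to its compression `P * HL * P`. -/
structure IsRenormalization (HS HL P : Matrix n n ℂ) (a C : ℝ) : Prop where
  nonneg_left : 0 ≤ HS
  nonneg_right : 0 ≤ HL
  isHermitian : P.IsHermitian
  mul_self : P * P = P
  left_mul : HS * P = 0
  one_sub_le : 1 - P ≤ a • HS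
  compression_le : P * HL * P ≤ C • (HS + HL)

namespace IsRenormalization

variable {HS HL P : Matrix n n ℂ} {a C γ : ℝ}

lemma compression_eq (r : IsRenormalization HS HL P a C) :
    P * (HS + HL) * P = P * HL * P := by
  rw [mul_add, add_mul, mul_assoc P HS P, r.left_mul, mul_zero, zero_add]

lemma compression_nonneg (r : IsRenormalization HS HL P a C) : 0 ≤ P * HL * P :=
  conj_nonneg r.nonneg_right r.isHermitian

lemma left_le (r : IsRenormalization HS HL P a C) : HS ≤ HS + HL :=
  le_add_of_nonneg_right r.nonneg_right

lemma one_sub_nonneg (r : IsRenormalization HS HL P a C) : 0 ≤ 1 - P :=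
  nonneg_of_isHermitian_of_mul_self (isHermitian_one_sub r.isHermitian) (by
    simp [mul_sub, sub_mul, r.mul_self])

/-- Zero modes of the full Hamiltonian are fixed by the projection. -/
lemma proj_mul_of_mul_eq_zero (r : IsRenormalization HS HL P a C) {B : Matrix n n ℂ}
    (h : (HS + HL) * B = 0) : P * B = B := by
  have h1 : Bᴴ * HS * B = 0 := by
    apply le_antisymm
    · have := conj_le r.left_le B
      rwa [mul_assoc _ (HS + HL), h, mul_zero] at this
    · simpa using conj_le r.nonneg_left B
  have h2 : Bᴴ * (1 - P) * B = 0 := by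
    apply le_antisymm
    · have := conj_le r.one_sub_le B
      rwa [mul_smul_comm, smul_mul_assoc, h1, smul_zero] at this
    · simpa using conj_le r.one_sub_nonneg B
  have h3 := mul_eq_zero_of_conj_eq_zero r.one_sub_nonneg h2
  rw [sub_mul, one_mul, sub_eq_zero] at h3
  exact h3.symm

/-- Zero modes of the full Hamiltonian are zero modes of the compression. -/
lemma compression_mul_of_mul_eq_zero (r : IsRenormalization HS HL P a C) {B : Matrix n n ℂ}
    (h : (HS + HL) * B = 0) : P * HL * P * B = 0 := by
  rw [← r.compression_eq, mul_assoc, r.proj_mul_of_mul_eq_zero h, mul_assoc, h, mul_zero]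

/-- The projection maps zero modes of the compression to zero modes of the full Hamiltonian. -/
lemma mul_proj_of_compression_mul_eq_zero (r : IsRenormalization HS HL P a C) {B : Matrix n n ℂ}
    (h : P * HL * P * B = 0) : (HS + HL) * (P * B) = 0 := by
  have h1 : HL * (P * B) = 0 := by
    apply mul_eq_zero_of_conj_eq_zero r.nonneg_right
    rw [conjTranspose_mul, r.isHermitian.eq]
    calc Bᴴ * P * HL * (P * B) = Bᴴ * (P * HL * P * B) := by simp only [mul_assoc]
      _ = 0 := by rw [h, mul_zero]
  rw [add_mul, h1, ← mul_assoc, r.left_mul, zero_mul, add_zero]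

lemma gap_compression (r : IsRenormalization HS HL P a C)
    (h : γ • (1 - kerProj (HS + HL)) ≤ HS + HL) :
    γ • (1 - kerProj (P * HL * P)) ≤ P * HL * P := by
  set G := kerProj (HS + HL)
  set K := kerProj (P * HL * P)
  have hK : K.IsHermitian := isHermitian_kerProj _
  have hKG : K * G = G :=
    kerProj_mul_of_mul_eq_zero (r.compression_mul_of_mul_eq_zero (mul_kerProj _))
  have hKP : K * (1 - P) = 1 - P := kerProj_mul_of_mul_eq_zero (by
    rw [mul_sub, mul_one, mul_assoc _ P P, r.mul_self, sub_self])
  have hKPK : (1 - K) * (1 - P) = 0 := by rw [sub_mul, one_mul, hKP, sub_self]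
  have hKGK : (1 - K) * G = 0 := by rw [sub_mul, one_mul, hKG, sub_self]
  have e : (1 - K) * (P * (1 - G) * P) * (1 - K) = 1 - K := by
    have e1 : (1 - K) * P = 1 - K := by
      rw [mul_sub, mul_one, sub_eq_zero] at hKPK
      exact hKPK.symm
    have e2 : P * (1 - K) = 1 - K := by
      have := congrArg conjTranspose e1
      rwa [conjTranspose_mul, r.isHermitian.eq, (isHermitian_one_sub hK).eq] at this
    calc (1 - K) * (P * (1 - G) * P) * (1 - K)
        = ((1 - K) * P) * (1 - G) * (P * (1 - K)) := by simp only [mul_assoc]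
      _ = (1 - K) * (1 - K) := by rw [e1, e2, mul_sub (1 - K) 1 G, mul_one, hKGK, sub_zero]
      _ = 1 - K := by simp [mul_sub, sub_mul, K, kerProj_mul_self]
  have h2 := conj_le_of_isHermitian (conj_le_of_isHermitian h r.isHermitian)
    (isHermitian_one_sub hK)
  rw [r.compression_eq, one_sub_kerProj_conj (isHermitian_of_nonneg r.compression_nonneg)] at h2
  simpa only [mul_smul_comm, smul_mul_assoc, e] using h2

lemma gap_of_compression (r : IsRenormalization HS HL P a C) (ha : 0 ≤ a) (hC : 0 ≤ C)
    (hγ : 0 < γ) (h : γ • (1 - kerProj (P * HL * P)) ≤ P * HL * P) :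
    (C / γ + a + 1)⁻¹ • (1 - kerProj (HS + HL)) ≤ HS + HL := by
  have hH : 0 ≤ HS + HL := add_nonneg r.nonneg_left r.nonneg_right
  set G := kerProj (HS + HL)
  set K := kerProj (P * HL * P)
  have hG : (1 - G).IsHermitian := isHermitian_one_sub (isHermitian_kerProj _)
  have hGPK : (1 - G) * (P * K) = 0 := by
    rw [sub_mul, one_mul, sub_eq_zero]
    exact (kerProj_mul_of_mul_eq_zero
      (r.mul_proj_of_compression_mul_eq_zero (mul_kerProj _))).symm
  have hPc : γ • ((1 - G) * P * (1 - G)) ≤ C • (HS + HL) := by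
    have h2 := conj_le_of_isHermitian ((conj_le_of_isHermitian h r.isHermitian).trans
      (b := P * (P * HL * P) * P) (c := C • (HS + HL)) (by
        rw [show P * (P * HL * P) * P = (P * P) * HL * (P * P) by simp only [mul_assoc],
          r.mul_self]
        exact r.compression_le)) hG
    have e : (1 - G) * (P * (1 - K) * P) * (1 - G) = (1 - G) * P * (1 - G) := by
      calc (1 - G) * (P * (1 - K) * P) * (1 - G)
          = (1 - G) * (P * P) * (1 - G) - ((1 - G) * (P * K)) * P * (1 - G) := by
            simp only [mul_sub, sub_mul, mul_one, one_mul, mul_assoc]; abel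
        _ = _ := by rw [hGPK, r.mul_self, zero_mul, zero_mul, sub_zero]
    rwa [mul_smul_comm, smul_mul_assoc, mul_smul_comm, smul_mul_assoc, e, mul_smul_comm,
      smul_mul_assoc, one_sub_kerProj_conj (isHermitian_of_nonneg hH)] at h2
  have hQ : (1 - G) * (1 - P) * (1 - G) ≤ a • (HS + HL) := by
    have := conj_le_of_isHermitian (r.one_sub_le.trans (smul_le_smul_of_nonneg_left r.left_le ha))
      hG
    rwa [mul_smul_comm, smul_mul_assoc, one_sub_kerProj_conj (isHermitian_of_nonneg hH)] at this
  have hsum : 1 - G ≤ (C / γ + a) • (HS + HL) := by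
    have h3 : (1 - G) * P * (1 - G) ≤ (C / γ) • (HS + HL) := by
      have := smul_le_smul_of_nonneg_left hPc (inv_nonneg.2 hγ.le)
      rwa [smul_smul, inv_mul_cancel₀ hγ.ne', one_smul, smul_smul, mul_comm, ← div_eq_mul_inv]
        at this
    calc 1 - G = (1 - G) * P * (1 - G) + (1 - G) * (1 - P) * (1 - G) := by
          rw [← add_mul, ← mul_add, add_sub_cancel, mul_one]
          simp [mul_sub, sub_mul, G, kerProj_mul_self]
      _ ≤ _ := by
          rw [add_smul]
          exact add_le_add h3 hQ
  have hpos : 0 < C / γ + a + 1 := by positivity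
  have h4 : 1 - G ≤ (C / γ + a + 1) • (HS + HL) := by
    rw [add_smul (C / γ + a), one_smul]
    exact hsum.trans (le_add_of_nonneg_right hH)
  have := smul_le_smul_of_nonneg_left h4 (inv_nonneg.2 hpos.le)
  rwa [smul_smul, inv_mul_cancel₀ hpos.ne', one_smul] at this

end IsRenormalization

/-- Commuting orthogonal projections: a union bound. -/
lemma one_sub_mul_le {A B : Matrix n n ℂ} (hA : A.IsHermitian) (hAA : A * A = A)
    (hB : B.IsHermitian) (hBB : B * B = B) (hAB : A * B = B * A) :
    1 - A * B ≤ (1 - A) + (1 - B) := by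
  have h : 0 ≤ (1 - A) * (1 - B) := by
    have h1 : 0 ≤ (1 - A) * (1 - B) * (1 - A) :=
      conj_nonneg (nonneg_of_isHermitian_of_mul_self (isHermitian_one_sub hB)
        (by simp [mul_sub, sub_mul, hBB])) (isHermitian_one_sub hA)
    have hc : (1 - A) * (1 - B) = (1 - B) * (1 - A) := by
      simp only [mul_sub, sub_mul, mul_one, one_mul, hAB]; abel
    rwa [hc, mul_assoc, show (1 - A) * (1 - A) = 1 - A by simp [mul_sub, sub_mul, hAA], ← hc] at h1
  rw [← sub_nonneg]
  convert h using 1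
  simp only [mul_sub, sub_mul, mul_one, one_mul]; abel

/-- Compressing a positive operator by a projection that commutes with it decreases it. -/
lemma compression_le_of_commute {X R : Matrix n n ℂ} (hX : 0 ≤ X) (hR : R.IsHermitian)
    (hRR : R * R = R) (hc : R * X = X * R) : R * X * R ≤ X := by
  have h := conj_nonneg hX (isHermitian_one_sub hR)
  have e : (1 - R) * X * (1 - R) = X - R * X * R := by
    have : R * X * R = R * X := by rw [hc, mul_assoc, hRR]
    simp only [mul_sub, sub_mul, mul_one, one_mul, this, ← hc]; abel
  rwa [e, sub_nonneg] at h

/-- The energy of a compressed state is bounded by the energy of the state and the weight that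
the compression removes. -/
lemma compression_le_two_smul {X R T : Matrix n n ℂ} {c : ℝ} (hX : 0 ≤ X)
    (hXc : X ≤ c • (1 : Matrix n n ℂ)) (hR : R.IsHermitian) (hRR : R * R = R)
    (hT : T.IsHermitian) (hTT : T * T = T) (hRX : R * X = X * R) (hRT : R * T = T * R) :
    (R * T) * X * (R * T) ≤ (2 : ℝ) • (X + c • (1 - T)) := by
  have h1 : (R * T) * X * (R * T) ≤ T * X * T := by
    have h := compression_le_of_commute (conj_nonneg hX hT) hR hRR (X := T * X * T) (by
      calc R * (T * X * T) = (R * T) * X * T := by simp only [mul_assoc]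
        _ = T * (R * X) * T := by rw [hRT]; simp only [mul_assoc]
        _ = T * X * (R * T) := by rw [hRX]; simp only [mul_assoc]
        _ = T * X * T * R := by rw [hRT]; simp only [mul_assoc])
    convert h using 1
    calc (R * T) * X * (R * T) = R * T * X * (T * R) := by rw [← hRT]
      _ = _ := by simp only [mul_assoc]
  have h2 : T * X * T ≤ (2 : ℝ) • (X + (1 - T) * X * (1 - T)) := by
    have h := conj_nonneg hX (C := 2 - T) ((by
      rw [← one_add_one_eq_two]; exact (isHermitian_one.add isHermitian_one).sub hT))
    rw [← sub_nonneg]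
    rw [two_smul]
    convert h using 1
    simp only [← one_add_one_eq_two, mul_sub, sub_mul, mul_one, one_mul, mul_add, add_mul]
    abel
  have h3 : (1 - T) * X * (1 - T) ≤ c • (1 - T) := by
    have h := conj_le_of_isHermitian hXc (isHermitian_one_sub hT)
    rwa [mul_smul_comm, smul_mul_assoc, mul_one,
      show (1 - T) * (1 - T) = 1 - T by simp [mul_sub, sub_mul, hTT]] at h
  exact h1.trans (h2.trans (smul_le_smul_of_nonneg_left (add_le_add_right h3 _) zero_le_two))

end Transfer

section Bond

variable {d : ℕ} {ι : Type} [Fintype ι] [DecidableEq ι]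

/-- Splitting off the spins at two distinct sites from a configuration. -/
def splitPair {a b : ι} (hab : a ≠ b) :
    (ι → Fin d) ≃ (Fin d × Fin d) × ({c : ι // c ≠ a ∧ c ≠ b} → Fin d) where
  toFun s := ((s a, s b), fun c => s c)
  invFun p c := if ha : c = a then p.1.1 else if hb : c = b then p.1.2 else p.2 ⟨c, ha, hb⟩
  left_inv s := by
    ext c
    by_cases ha : c = a
    · simp [ha]
    · by_cases hb : c = b
      · subst hb; simp [ha]
      · simp [ha, hb]
  right_inv p := by
    refine Prod.ext (Prod.ext ?_ ?_) (funext fun c => ?_)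
    · simp
    · simp [hab.symm]
    · simp [c.2.1, c.2.2]

lemma bondOp_eq_submatrix (A : Matrix (Fin d × Fin d) (Fin d × Fin d) ℂ) {a b : ι} (hab : a ≠ b) :
    bondOp A a b = (kroneckerMap (· * ·) A 1).submatrix (splitPair hab) (splitPair hab) := by
  ext s t
  have : (∀ c, c ≠ a → c ≠ b → s c = t c) ↔
      (splitPair (d := d) hab s).2 = (splitPair hab t).2 := by
    rw [funext_iff]
    exact ⟨fun h c => h c c.2.1 c.2.2, fun h c h1 h2 => h ⟨c, h1, h2⟩⟩
  simp only [bondOp, of_apply, submatrix_apply, kroneckerMap_apply, one_apply, this, mul_ite,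
    mul_one, mul_zero]
  rfl

lemma bondOp_nonneg {A : Matrix (Fin d × Fin d) (Fin d × Fin d) ℂ} (hA : 0 ≤ A) {a b : ι}
    (hab : a ≠ b) : 0 ≤ bondOp A a b := by
  rw [nonneg_iff_posSemidef] at hA ⊢
  rw [bondOp_eq_submatrix A hab]
  exact (hA.kronecker PosSemidef.one).submatrix _

lemma bondOp_le_smul_one {A : Matrix (Fin d × Fin d) (Fin d × Fin d) ℂ} {c : ℝ}
    (hA : A ≤ c • (1 : Matrix (Fin d × Fin d) (Fin d × Fin d) ℂ)) {a b : ι} (hab : a ≠ b) :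
    bondOp A a b ≤ c • (1 : Matrix (ι → Fin d) (ι → Fin d) ℂ) := by
  have h := bondOp_nonneg (sub_nonneg.2 hA) hab
  rw [← sub_nonneg]
  convert h using 1
  have h1 : c • (1 : Matrix (ι → Fin d) (ι → Fin d) ℂ) =
      bondOp (c • (1 : Matrix (Fin d × Fin d) (Fin d × Fin d) ℂ)) a b := by
    rw [bondOp_eq_submatrix _ hab]
    rw [show kroneckerMap (· * ·) (c • (1 : Matrix (Fin d × Fin d) (Fin d × Fin d) ℂ))
      (1 : Matrix ({c : ι // c ≠ a ∧ c ≠ b} → Fin d) _ ℂ) = c • 1 from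
        (smul_kronecker c _ _).trans (by rw [one_kronecker_one])]
    exact (congrArg (c • ·) (submatrix_one_equiv (splitPair hab))).symm
  rw [h1]
  ext s t
  simp only [bondOp, Matrix.sub_apply, of_apply]
  split_ifs <;> simp

lemma segmentHam_nonneg {A : Matrix (Fin d × Fin d) (Fin d × Fin d) ℂ} (hA : 0 ≤ A) (L : ℕ) :
    0 ≤ segmentHam A L := by
  refine Finset.sum_nonneg fun i _ => Finset.sum_nonneg fun k _ => ?_
  split_ifs with h
  · exact bondOp_nonneg hA (by rintro rfl; omega)
  · rfl

end Bond

section Segment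

variable {d L m : ℕ}

/-- The tensor product of one operator for each segment. -/
def segmentsOp (A : Fin m → Matrix (Fin L → Fin d) (Fin L → Fin d) ℂ) :
    Matrix (Config d L m) (Config d L m) ℂ :=
  Matrix.of fun s t => ∏ j, A j (fun k => s (j, k)) (fun k => t (j, k))

lemma segmentsOp_mul (A B : Fin m → Matrix (Fin L → Fin d) (Fin L → Fin d) ℂ) :
    segmentsOp (A * B) = segmentsOp A * segmentsOp B := by
  ext s t
  simp only [segmentsOp, of_apply, mul_apply, Pi.mul_apply, ← Finset.prod_mul_distrib]
  rw [Finset.prod_univ_sum, Fintype.piFinset_univ]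
  exact (Fintype.sum_equiv (Equiv.curry (Fin m) (Fin L) (Fin d)) _ _ fun u => rfl).symm

lemma segmentsOp_one :
    segmentsOp (1 : Fin m → Matrix (Fin L → Fin d) (Fin L → Fin d) ℂ) = 1 := by
  ext s t
  simp only [segmentsOp, of_apply, Pi.one_apply, one_apply]
  rw [Finset.prod_ite_zero]
  simp only [Finset.mem_univ, true_implies, Finset.prod_const_one]
  congr 1
  simp only [funext_iff, Prod.forall]

lemma isHermitian_segmentsOp {A : Fin m → Matrix (Fin L → Fin d) (Fin L → Fin d) ℂ}
    (hA : ∀ j, (A j).IsHermitian) : (segmentsOp A).IsHermitian := by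
  ext s t
  simp only [segmentsOp, conjTranspose_apply, of_apply, star_prod]
  exact Finset.prod_congr rfl fun j _ => (hA j).apply _ _

lemma onSegment_eq_segmentsOp (A : Matrix (Fin L → Fin d) (Fin L → Fin d) ℂ) (j : Fin m) :
    onSegment A j = segmentsOp (Pi.mulSingle j A) := by
  ext s t
  simp only [onSegment, segmentsOp, of_apply]
  rw [← Finset.mul_prod_erase _ _ (Finset.mem_univ j), Pi.mulSingle_eq_same]
  have h : ∏ i ∈ Finset.univ.erase j, (Pi.mulSingle j A : Fin m → _) i (fun k => s (i, k))
      (fun k => t (i, k)) = if ∀ c : Fin m × Fin L, c.1 ≠ j → s c = t c then 1 else 0 := by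
    rw [Finset.prod_congr rfl (g := fun i => if (fun k => s (i, k)) = fun k => t (i, k) then
      (1 : ℂ) else 0) (fun i hi => by
        rw [Pi.mulSingle_eq_of_ne (Finset.ne_of_mem_erase hi), one_apply])]
    rw [Finset.prod_ite_zero]
    simp only [Finset.prod_const_one]
    congr 1
    simp only [Finset.mem_erase, Finset.mem_univ, and_true, funext_iff, Prod.forall, eq_iff_iff]
    exact ⟨fun h a b hab => h a hab b, fun h i hi k => h i k hi⟩
  rw [h, mul_ite, mul_one, mul_zero]

lemma onSegment_mul (A B : Matrix (Fin L → Fin d) (Fin L → Fin d) ℂ) (j : Fin m) :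
    onSegment (A * B) j = onSegment A j * onSegment B j := by
  simp only [onSegment_eq_segmentsOp, Pi.mulSingle_mul, segmentsOp_mul]

lemma onSegment_one (j : Fin m) :
    onSegment (1 : Matrix (Fin L → Fin d) (Fin L → Fin d) ℂ) j = 1 := by
  rw [onSegment_eq_segmentsOp, Pi.mulSingle_one, segmentsOp_one]

lemma onSegment_sub (A B : Matrix (Fin L → Fin d) (Fin L → Fin d) ℂ) (j : Fin m) :
    onSegment (A - B) j = onSegment A j - onSegment B j := by
  ext s t
  simp only [onSegment, Matrix.sub_apply, of_apply]
  split_ifs <;> simp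

lemma onSegment_smul (c : ℝ) (A : Matrix (Fin L → Fin d) (Fin L → Fin d) ℂ) (j : Fin m) :
    onSegment (c • A) j = c • onSegment A j := by
  ext s t
  simp only [onSegment, Matrix.smul_apply, of_apply]
  split_ifs <;> simp

lemma onSegment_conjTranspose (A : Matrix (Fin L → Fin d) (Fin L → Fin d) ℂ) (j : Fin m) :
    onSegment Aᴴ j = (onSegment A j)ᴴ := by
  ext s t
  simp only [onSegment, conjTranspose_apply, of_apply, eq_comm]
  split_ifs <;> simp

lemma onSegment_nonneg {A : Matrix (Fin L → Fin d) (Fin L → Fin d) ℂ} (hA : 0 ≤ A) (j : Fin m) :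
    0 ≤ onSegment A j := by
  obtain ⟨B, rfl⟩ := CStarAlgebra.nonneg_iff_eq_star_mul_self.1 hA
  rw [onSegment_mul, star_eq_conjTranspose, onSegment_conjTranspose, nonneg_iff_posSemidef]
  exact posSemidef_conjTranspose_mul_self _

lemma onSegment_le {A B : Matrix (Fin L → Fin d) (Fin L → Fin d) ℂ} (h : A ≤ B) (j : Fin m) :
    onSegment A j ≤ onSegment B j := by
  rw [← sub_nonneg, ← onSegment_sub]
  exact onSegment_nonneg (sub_nonneg.2 h) j

/-- Operators on all segments but two commute with a bond operator between these two. -/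
lemma segmentsOp_mul_bondOp {A : Fin m → Matrix (Fin L → Fin d) (Fin L → Fin d) ℂ}
    (B : Matrix (Fin d × Fin d) (Fin d × Fin d) ℂ) {a b : Fin m × Fin L}
    (ha : A a.1 = 1) (hb : A b.1 = 1) :
    segmentsOp A * bondOp B a b = bondOp B a b * segmentsOp A := by
  ext s t
  set p : Fin m × Fin L → Prop := fun c => c.1 = a.1 ∨ c.1 = b.1
  have hA0 : ∀ u v : Config d L m, segmentsOp A u v ≠ 0 → ∀ c, p c → u c = v c := by
    intro u v h c hc
    have h1 : A c.1 (fun k => u (c.1, k)) (fun k => v (c.1, k)) ≠ 0 :=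
      by
      simp only [segmentsOp, of_apply] at h
      exact Finset.prod_ne_zero_iff.1 h c.1 (Finset.mem_univ _)
    have h2 : A c.1 = 1 := by rcases hc with hc | hc <;> rw [hc] <;> assumption
    rw [h2, one_apply] at h1
    exact congrFun (of_not_not fun h3 => h1 (if_neg h3)) c.2
  have hB0 : ∀ u v : Config d L m, bondOp B a b u v ≠ 0 → ∀ c, ¬ p c → u c = v c := by
    intro u v h c hc
    have h1 : ∀ c, c ≠ a → c ≠ b → u c = v c := of_not_not fun h3 => h (if_neg h3)
    exact h1 c (fun e => hc (Or.inl (by rw [e]))) (fun e => hc (Or.inr (by rw [e])))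
  simp only [mul_apply]
  rw [Finset.sum_eq_single (fun c => if p c then s c else t c), Finset.sum_eq_single
    (fun c => if p c then t c else s c)]
  · rw [mul_comm]
    congr 1
    · have e : (∀ c, c ≠ a → c ≠ b → (if p c then s c else t c) = t c) ↔
          ∀ c, c ≠ a → c ≠ b → s c = (if p c then t c else s c) := by
        refine forall_congr' fun c => imp_congr_right fun _ => imp_congr_right fun _ => ?_
        split_ifs <;> simp
      have pa : p a := Or.inl rfl
      have pb : p b := Or.inr rfl
      simp only [bondOp, of_apply, e, pa, pb, if_true]
    · simp only [segmentsOp, of_apply]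
      refine Finset.prod_congr rfl fun j _ => ?_
      by_cases hj : j = a.1 ∨ j = b.1
      · have h2 : A j = 1 := by rcases hj with hc | hc <;> rw [hc] <;> assumption
        simp [p, hj, h2]
      · simp [p, hj]
  · intro u _ hu
    by_contra h
    apply hu
    funext c
    split_ifs with hc
    · exact hA0 _ _ (right_ne_zero_of_mul h) c hc
    · exact (hB0 _ _ (left_ne_zero_of_mul h) c hc).symm
  · simp
  · intro u _ hu
    by_contra h
    apply hu
    funext c
    split_ifs with hc
    · exact (hA0 _ _ (left_ne_zero_of_mul h) c hc).symm
    · exact hB0 _ _ (right_ne_zero_of_mul h) c hc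
  · simp

end Segment

section Projections

variable {d L m : ℕ}

/-- The projection `P`, applied to each of the segments in `T`. -/
def projOn (P : Matrix (Fin L → Fin d) (Fin L → Fin d) ℂ) (T : Finset (Fin m)) :
    Matrix (Config d L m) (Config d L m) ℂ :=
  segmentsOp fun j => if j ∈ T then P else 1

variable {P : Matrix (Fin L → Fin d) (Fin L → Fin d) ℂ}

lemma projOn_mul (hPP : P * P = P) (S T : Finset (Fin m)) :
    projOn P S * projOn P T = projOn P (S ∪ T) := by
  rw [projOn, projOn, ← segmentsOp_mul, projOn]
  congr 1
  funext j
  by_cases h1 : j ∈ S <;> by_cases h2 : j ∈ T <;> simp [h1, h2, hPP]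

lemma projOn_mul_self (hPP : P * P = P) (T : Finset (Fin m)) :
    projOn P T * projOn P T = projOn P T := by
  rw [projOn_mul hPP, Finset.union_self]

lemma projOn_commute (hPP : P * P = P) (S T : Finset (Fin m)) :
    projOn P S * projOn P T = projOn P T * projOn P S := by
  rw [projOn_mul hPP, projOn_mul hPP, Finset.union_comm]

lemma isHermitian_projOn (hP : P.IsHermitian) (T : Finset (Fin m)) : (projOn P T).IsHermitian := by
  refine isHermitian_segmentsOp fun j => ?_
  split_ifs
  exacts [hP, isHermitian_one]

lemma projOn_empty : projOn P (∅ : Finset (Fin m)) = 1 := by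
  simp only [projOn, Finset.notMem_empty, if_false]
  exact segmentsOp_one

lemma onSegment_eq_projOn (j : Fin m) : onSegment P j = projOn P {j} := by
  rw [onSegment_eq_segmentsOp, projOn]
  congr 1
  funext i
  simp only [Pi.mulSingle_apply, Finset.mem_singleton]

lemma one_sub_projOn_le (hP : P.IsHermitian) (hPP : P * P = P) (T : Finset (Fin m)) :
    1 - projOn P T ≤ ∑ j ∈ T, (1 - onSegment P j) := by
  induction T using Finset.induction_on with
  | empty => rw [projOn_empty, sub_self, Finset.sum_empty]
  | insert j T hj ih =>
    rw [Finset.sum_insert hj, Finset.insert_eq, ← projOn_mul hPP, onSegment_eq_projOn]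
    exact (one_sub_mul_le (isHermitian_projOn hP _) (projOn_mul_self hPP _)
      (isHermitian_projOn hP _) (projOn_mul_self hPP _) (projOn_commute hPP _ _)).trans
      (add_le_add_right ih _)

lemma onSegment_one_sub_nonneg (hP : P.IsHermitian) (hPP : P * P = P) (j : Fin m) :
    0 ≤ 1 - onSegment P j := by
  refine nonneg_of_isHermitian_of_mul_self
    (isHermitian_one_sub (onSegment_eq_projOn (P := P) j ▸ isHermitian_projOn hP _)) ?_
  simp [mul_sub, sub_mul, ← onSegment_mul, hPP]

end Projections

section Chain

variable {d : ℕ} {Hbar : Matrix (Fin d × Fin d) (Fin d × Fin d) ℂ} {L m : ℕ}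

lemma isHermitian_segmentProj : (segmentProj Hbar L).IsHermitian :=
  isHermitian_kerProj _

lemma segmentProj_mul_self : segmentProj Hbar L * segmentProj Hbar L = segmentProj Hbar L :=
  kerProj_mul_self _

lemma segmentsProj_eq_projOn : segmentsProj Hbar L m = projOn (segmentProj Hbar L) Finset.univ := by
  simp only [projOn, Finset.mem_univ, if_true]
  rfl

lemma segmentsHam_nonneg (hH : 0 ≤ Hbar) : 0 ≤ segmentsHam Hbar L m :=
  Finset.sum_nonneg fun j _ => onSegment_nonneg (segmentHam_nonneg hH L) j

lemma IsLink.ne {a b : Fin m × Fin L} (h : IsLink a b) : a.1 ≠ b.1 := by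
  intro e
  have := h.1
  rw [e] at this
  omega

lemma linkHam_nonneg (hH : 0 ≤ Hbar) : 0 ≤ linkHam Hbar L m := by
  refine Finset.sum_nonneg fun a _ => Finset.sum_nonneg fun b _ => ?_
  split_ifs with h
  · exact bondOp_nonneg hH fun e => h.ne (congrArg Prod.fst e)
  · rfl

lemma segmentsHam_mul_segmentsProj : segmentsHam Hbar L m * segmentsProj Hbar L m = 0 := by
  rw [segmentsHam, Finset.sum_mul]
  refine Finset.sum_eq_zero fun j _ => ?_
  have h : segmentsProj Hbar L m = onSegment (segmentProj Hbar L) j * segmentsProj Hbar L m := by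
    rw [segmentsProj_eq_projOn, onSegment_eq_projOn, projOn_mul segmentProj_mul_self]
    congr 1
    simp
  rw [h, ← mul_assoc, ← onSegment_mul, segmentProj, mul_kerProj]
  have h0 : onSegment (0 : Matrix (Fin L → Fin d) (Fin L → Fin d) ℂ) j = 0 := by
    rw [← sub_self 0, onSegment_sub, sub_self]
  rw [h0, zero_mul]

lemma smul_sum_one_sub_le_segmentsHam {δ : ℝ}
    (hδ : δ • (1 - segmentProj Hbar L) ≤ segmentHam Hbar L) :
    δ • ∑ j : Fin m, (1 - onSegment (segmentProj Hbar L) j) ≤ segmentsHam Hbar L m := by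
  rw [Finset.smul_sum]
  refine Finset.sum_le_sum fun j _ => ?_
  have := onSegment_le hδ j
  rwa [onSegment_smul, onSegment_sub, onSegment_one] at this

lemma sum_ite_le_of_unique {n ι : Type} [Fintype n] [DecidableEq n] [Fintype ι]
    (p : ι → Prop) [DecidablePred p] (hp : ∀ a b, p a → p b → a = b) {X : Matrix n n ℂ}
    (hX : 0 ≤ X) : ∑ i, (if p i then X else 0) ≤ X := by
  by_cases h : ∃ i, p i
  · obtain ⟨i, hi⟩ := h
    rw [Finset.sum_eq_single i (fun b _ hb => if_neg fun h => hb (hp _ _ h hi)) (by simp),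
      if_pos hi]
  · push Not at h
    simpa [h] using hX

lemma sum_link_le {n : Type} [Fintype n] [DecidableEq n] {Q : Fin m → Matrix n n ℂ}
    (hQ : ∀ j, 0 ≤ Q j) :
    ∑ a : Fin m × Fin L, ∑ b : Fin m × Fin L, (if IsLink a b then Q a.1 + Q b.1 else 0) ≤
      (2 * L : ℝ) • ∑ j, Q j := by
  have h1 : ∑ a : Fin m × Fin L, ∑ b : Fin m × Fin L, (if IsLink a b then Q a.1 else 0) ≤
      (L : ℝ) • ∑ j, Q j := by
    calc _ ≤ ∑ a : Fin m × Fin L, Q a.1 := Finset.sum_le_sum fun a _ =>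
          sum_ite_le_of_unique _ (fun b b' h h' => Prod.ext
            (Fin.ext (h.1.symm.trans h'.1)) (Fin.ext (h.2.2.trans h'.2.2.symm))) (hQ _)
      _ = _ := by
          rw [Fintype.sum_prod_type]
          simp only [Finset.sum_const, Finset.card_univ, Fintype.card_fin, Nat.cast_smul_eq_nsmul,
            Finset.smul_sum]
  have h2 : ∑ a : Fin m × Fin L, ∑ b : Fin m × Fin L, (if IsLink a b then Q b.1 else 0) ≤
      (L : ℝ) • ∑ j, Q j := by
    rw [Finset.sum_comm]
    calc _ ≤ ∑ b : Fin m × Fin L, Q b.1 := Finset.sum_le_sum fun b _ =>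
          sum_ite_le_of_unique (fun a => IsLink a b) (fun a a' h h' => Prod.ext
            (Fin.ext (by have := h.1; have := h'.1; omega))
            (Fin.ext (by have := h.2.1; have := h'.2.1; omega))) (hQ _)
      _ = _ := by
          rw [Fintype.sum_prod_type]
          simp only [Finset.sum_const, Finset.card_univ, Fintype.card_fin, Nat.cast_smul_eq_nsmul,
            Finset.smul_sum]
  rw [two_mul, add_smul]
  refine le_trans (le_of_eq ?_) (add_le_add h1 h2)
  simp only [← Finset.sum_add_distrib]
  refine Finset.sum_congr rfl fun a _ => Finset.sum_congr rfl fun b _ => ?_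
  split_ifs <;> simp

lemma compression_bondOp_le (hH : 0 ≤ Hbar) {c : ℝ} (hc : 0 ≤ c)
    (hHc : Hbar ≤ c • (1 : Matrix (Fin d × Fin d) (Fin d × Fin d) ℂ))
    {a b : Fin m × Fin L} (hab : a.1 ≠ b.1) :
    segmentsProj Hbar L m * bondOp Hbar a b * segmentsProj Hbar L m ≤
      (2 : ℝ) • (bondOp Hbar a b + c • ((1 - onSegment (segmentProj Hbar L) a.1) +
        (1 - onSegment (segmentProj Hbar L) b.1))) := by
  have hP := isHermitian_segmentProj (Hbar := Hbar) (L := L)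
  have hPP := segmentProj_mul_self (Hbar := Hbar) (L := L)
  have hne : a ≠ b := fun e => hab (congrArg Prod.fst e)
  have hsplit : segmentsProj Hbar L m = projOn (segmentProj Hbar L) {a.1, b.1}ᶜ *
      projOn (segmentProj Hbar L) {a.1, b.1} := by
    rw [segmentsProj_eq_projOn, projOn_mul hPP]
    congr 1
    rw [Finset.union_comm, Finset.union_compl]
  rw [hsplit]
  refine (compression_le_two_smul (bondOp_nonneg hH hne) (bondOp_le_smul_one hHc hne)
    (isHermitian_projOn hP _) (projOn_mul_self hPP _) (isHermitian_projOn hP _)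
    (projOn_mul_self hPP _) (segmentsOp_mul_bondOp _ ?_ ?_) (projOn_commute hPP _ _)).trans ?_
  · simp
  · simp
  · refine smul_le_smul_of_nonneg_left (add_le_add_right (smul_le_smul_of_nonneg_left ?_ hc) _)
      zero_le_two
    exact (one_sub_projOn_le hP hPP _).trans_eq (Finset.sum_pair hab)

lemma compression_linkHam_le (hH : 0 ≤ Hbar) {c : ℝ} (hc : 0 ≤ c)
    (hHc : Hbar ≤ c • (1 : Matrix (Fin d × Fin d) (Fin d × Fin d) ℂ)) :
    renormHam Hbar L m ≤ (2 : ℝ) • linkHam Hbar L m +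
      (4 * c * L) • ∑ j : Fin m, (1 - onSegment (segmentProj Hbar L) j) := by
  set P := segmentsProj Hbar L m
  set Q : Fin m → Matrix (Config d L m) (Config d L m) ℂ :=
    fun j => 1 - onSegment (segmentProj Hbar L) j
  have hQ : ∀ j, 0 ≤ Q j :=
    fun j => onSegment_one_sub_nonneg isHermitian_segmentProj segmentProj_mul_self j
  calc renormHam Hbar L m
      = ∑ a : Fin m × Fin L, ∑ b : Fin m × Fin L,
          (if IsLink a b then P * bondOp Hbar a b * P else 0) := by
        simp only [renormHam, linkHam, Finset.mul_sum, Finset.sum_mul]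
        refine Finset.sum_congr rfl fun a _ => Finset.sum_congr rfl fun b _ => ?_
        split_ifs <;> simp [P]
    _ ≤ ∑ a : Fin m × Fin L, ∑ b : Fin m × Fin L, ((2 : ℝ) • (if IsLink a b then
          bondOp Hbar a b else 0) + (2 * c) • (if IsLink a b then Q a.1 + Q b.1 else 0)) := by
        refine Finset.sum_le_sum fun a _ => Finset.sum_le_sum fun b _ => ?_
        split_ifs with h
        · rw [mul_smul, ← smul_add]
          exact compression_bondOp_le hH hc hHc h.ne
        · simp
    _ = (2 : ℝ) • linkHam Hbar L m + (2 * c) • ∑ a : Fin m × Fin L, ∑ b : Fin m × Fin L,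
          (if IsLink a b then Q a.1 + Q b.1 else 0) := by
        simp only [Finset.sum_add_distrib, ← Finset.smul_sum, linkHam]
    _ ≤ _ := by
        rw [show 4 * c * L = (2 * c) * (2 * L) by ring, mul_smul (2 * c)]
        exact add_le_add_right (smul_le_smul_of_nonneg_left (sum_link_le hQ) (by positivity)) _

lemma exists_isRenormalization (hH : 0 ≤ Hbar) (L : ℕ) : ∃ a C : ℝ, 0 ≤ a ∧ 0 ≤ C ∧
    ∀ m, IsRenormalization (segmentsHam Hbar L m) (linkHam Hbar L m) (segmentsProj Hbar L m)
      a C := by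
  obtain ⟨c, hc, hHc⟩ := exists_le_smul_one (isHermitian_of_nonneg hH)
  obtain ⟨δ, hδ, hgap⟩ := exists_pos_smul_one_sub_kerProj_le (segmentHam_nonneg hH L)
  have hsum : ∀ m, ∑ j : Fin m, (1 - onSegment (segmentProj Hbar L) j) ≤
      δ⁻¹ • segmentsHam Hbar L m := fun m => by
    have := smul_le_smul_of_nonneg_left (smul_sum_one_sub_le_segmentsHam (m := m) hgap)
      (inv_nonneg.2 hδ.le)
    rwa [smul_smul, inv_mul_cancel₀ hδ.ne', one_smul] at this
  refine ⟨δ⁻¹, 2 + 4 * c * L * δ⁻¹, by positivity, by positivity, fun m => ?_⟩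
  have hS := segmentsHam_nonneg (L := L) (m := m) hH
  have hL := linkHam_nonneg (L := L) (m := m) hH
  refine ⟨hS, hL, ?_, ?_, segmentsHam_mul_segmentsProj, ?_, ?_⟩
  · exact segmentsProj_eq_projOn (Hbar := Hbar) ▸ isHermitian_projOn isHermitian_segmentProj _
  · rw [segmentsProj_eq_projOn, projOn_mul_self segmentProj_mul_self]
  · rw [segmentsProj_eq_projOn]
    exact (one_sub_projOn_le isHermitian_segmentProj segmentProj_mul_self _).trans (hsum m)
  · refine (compression_linkHam_le hH hc hHc).trans ?_
    rw [add_smul]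
    refine add_le_add (smul_le_smul_of_nonneg_left (le_add_of_nonneg_left hS) zero_le_two) ?_
    rw [mul_smul (4 * c * L)]
    exact smul_le_smul_of_nonneg_left ((hsum m).trans (smul_le_smul_of_nonneg_left
      (le_add_of_nonneg_right hL) (inv_nonneg.2 hδ.le))) (by positivity)

end Chain

end SpinChain

theorem theorem1 (d L : ℕ) (hL : 0 < L)
    (Hbar : Matrix (Fin d × Fin d) (Fin d × Fin d) ℂ)
    (hff : SpinChain.IsFrustrationFree Hbar L) :
    SpinChain.IsGapped (fun m => SpinChain.chainHam Hbar L m) ↔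
      SpinChain.IsGapped (fun m => SpinChain.renormHam Hbar L m) := by
  open scoped MatrixOrder ComplexOrder in
  obtain ⟨a, C, ha, hC, r⟩ := SpinChain.exists_isRenormalization
    (Matrix.nonneg_iff_posSemidef.2 hff.1) L
  open scoped MatrixOrder ComplexOrder in
  have hchain : ∀ m γ, SpinChain.GapAtLeast (SpinChain.chainHam Hbar L m) γ ↔
      γ • (1 - SpinChain.kerProj (SpinChain.chainHam Hbar L m)) ≤ SpinChain.chainHam Hbar L m :=
    fun m γ => SpinChain.gapAtLeast_iff (add_nonneg (r m).nonneg_left (r m).nonneg_right)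
      (hff.2 m) γ
  open scoped MatrixOrder ComplexOrder in
  have hrenorm : ∀ m γ, SpinChain.GapAtLeast (SpinChain.renormHam Hbar L m) γ ↔
      γ • (1 - SpinChain.kerProj (SpinChain.renormHam Hbar L m)) ≤
        SpinChain.renormHam Hbar L m := by
    refine fun m γ => SpinChain.gapAtLeast_iff (r m).compression_nonneg ?_ γ
    obtain ⟨ψ, hψ, h⟩ := hff.2 m
    refine ⟨ψ, hψ, funext fun i => ?_⟩
    have h0 : SpinChain.chainHam Hbar L m *
        Matrix.of (fun i (_ : SpinChain.Config d L m) => ψ i) = 0 := by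
      ext i j
      exact congrFun h i
    exact congrFun (congrFun ((r m).compression_mul_of_mul_eq_zero h0) i) i
  constructor
  · rintro ⟨γ, hγ, h⟩
    exact ⟨γ, hγ, fun m => (hrenorm m γ).2 ((r m).gap_compression ((hchain m γ).1 (h m)))⟩
  · rintro ⟨γ, hγ, h⟩
    exact ⟨(C / γ + a + 1)⁻¹, by positivity,
      fun m => (hchain m _).2 ((r m).gap_of_compression ha hC hγ ((hrenorm m γ).1 (h m)))⟩
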